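/- Let $S$ be a set of unit squares of the lattice $\mathbb Z^2$, and let $G$ be the cell complex formed by these squares, their sides and their corners $v_{m,n}$, $(m,n)\in\mathbb Z^2$; assume that $G$ is simply connected (in particular nonempty and connected). A ring at a vertex $v_i$ of $G$ is a pair of concentric circles $c_i$, $C_i$ in $\mathbb R^2=\mathbb C$ with radii $|r_i|$ and $R_i>0$, where $r_i\in\mathbb R$ is signed ($r_i>0$: counter-clockwise, $r_i<0$: clockwise orientation, $r_i=0$: $c_i$ is a point); its area is $(R_i^2-r_i^2)\pi$. An orthogonal ring pattern on $G$ assigns a ring to every vertex of $G$ such that 1. for all neighbouring vertices $v_i,v_j$ (i.e. joined by a side of a square of $S$), $C_i$ intersects $c_j$ orthogonally and $c_i$ intersects $C_j$ orthogonally; 2. in each square of $S$ with lower left corner $v_{m,n}$, the inner circles $c_{m,n},c_{m+1,n+1}$ and the outer circles $C_{m+1,n},C_{m,n+1}$ pass through one point $q$; 3. for each such square, with $v_i$ either of the two corners $v_{m,n}$, $v_{m+1,n+1}$, and $v_j,v_k$ the corners that follow and precede $v_i$ in the counter-clockwise order around the square, the triangles (center of $v_i$, center of $v_j$, $q$) and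 (center of $v_i$, $q$, center of $v_k$) are counter-clockwise if $r_i>0$, clockwise if $r_i<0$ and degenerate if $r_i=0$; and the outer circles $C_{m+1,n},C_{m,n+1}$ touch externally at $q$ (this follows from the preceding conditions unless $r_{m,n}=r_{m+1,n+1}=0$). Let $\mathcal R$ be an orthogonal ring pattern on $G$ all of whose rings have area $\pi$, with $\rho$-radii $\rho_i\in\mathbb R$, that is, $r_i=\sinh\rho_i$ and $R_i=\cosh\rho_i$ for every vertex $v_i$ of $G$. Then the shifted $\rho$-radii $\rho_i^\delta=\rho_i+\delta$ define a one-parameter family of orthogonal ring patterns: there are orthogonal ring patterns $\mathcal R^\delta$ on $G$, $\delta\in\mathbb R$, with $\mathcal R^0=\mathcal R$ and with centers depending continuously on $\delta$, such that for all $\delta\in\mathbb R$ and all vertices $v_i$ of $G$ $$ r_i^\delta=\sinh(\rho_i+\delta),\qquad R_i^\delta=\cosh(\rho_i+\delta), $$ and every ring of $\mathcal R^\delta$ has area $\pi$. Moreover, if any two squares of $S$ can be joined by a chain of squares of $S$ in which consecutive squares share a side, then for every $\delta\in\mathbb R$ the orthogonal ring pattern on $G$ with $\rho$-radii $\rho_i+\delta$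 is unique up to an orientation-preserving isometry of the plane. -/

import Mathlib

namespace RingPattern

/-! ### Subcomplexes of the square lattice

A square of the lattice `ℤ²` is named by its lower left corner. A set `S` of squares determines the
subcomplex consisting of these squares, their sides and their corners. -/

/-- The lower right corner of the square `s`. -/
def se (s : ℤ × ℤ) : ℤ × ℤ := (s.1 + 1, s.2)

/-- The upper left corner of the square `s`. -/
def nw (s : ℤ × ℤ) : ℤ × ℤ := (s.1, s.2 + 1)

/-- The upper right corner of the square `s`. -/
def ne (s : ℤ × ℤ) : ℤ × ℤ := (s.1 + 1, s.2 + 1)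

/-- The vertices of the subcomplex: the corners of its squares. -/
def vertices (S : Set (ℤ × ℤ)) : Set (ℤ × ℤ) :=
  {v | ∃ s ∈ S, v = s ∨ v = se s ∨ v = ne s ∨ v = nw s}

/-- `v` and `w` are the first and the second endpoint of a (horizontal or vertical) oriented edge of
the subcomplex, i.e. of a side of one of its squares. -/
def IsEdge (S : Set (ℤ × ℤ)) (v w : ℤ × ℤ) : Prop :=
  ∃ s ∈ S, (v = s ∧ w = se s) ∨ (v = nw s ∧ w = ne s) ∨ (v = s ∧ w = nw s) ∨ (v = se s ∧ w = ne s)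

/-- The `1`-skeleton of the subcomplex. -/
def skeleton (S : Set (ℤ × ℤ)) : SimpleGraph (ℤ × ℤ) := SimpleGraph.fromRel (IsEdge S)

/-- Homotopy of edge paths (with fixed endpoints) in the subcomplex: the smallest congruence with
respect to concatenation for which an edge followed by its reverse is trivial and for which a path
may be pushed across a square of the subcomplex. -/
inductive EdgeHomotopic (S : Set (ℤ × ℤ)) :
    ∀ {v w : ℤ × ℤ}, (skeleton S).Walk v w → (skeleton S).Walk v w → Prop
  | refl {v w : ℤ × ℤ} (p : (skeleton S).Walk v w) : EdgeHomotopic S p p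
  | symm {v w : ℤ × ℤ} {p q : (skeleton S).Walk v w} :
      EdgeHomotopic S p q → EdgeHomotopic S q p
  | trans {v w : ℤ × ℤ} {p q k : (skeleton S).Walk v w} :
      EdgeHomotopic S p q → EdgeHomotopic S q k → EdgeHomotopic S p k
  | append {v w x : ℤ × ℤ} {p p' : (skeleton S).Walk v w} {q q' : (skeleton S).Walk w x} :
      EdgeHomotopic S p p' → EdgeHomotopic S q q' →
        EdgeHomotopic S (p.append q) (p'.append q')
  | backtrack {v w : ℤ × ℤ} (h : (skeleton S).Adj v w) (h' : (skeleton S).Adj w v) :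
      EdgeHomotopic S (.cons h (.cons h' .nil)) .nil
  | square {s : ℤ × ℤ} (hs : s ∈ S)
      (h₁ : (skeleton S).Adj s (se s)) (h₂ : (skeleton S).Adj (se s) (ne s))
      (h₃ : (skeleton S).Adj s (nw s)) (h₄ : (skeleton S).Adj (nw s) (ne s)) :
      EdgeHomotopic S (.cons h₁ (.cons h₂ .nil)) (.cons h₃ (.cons h₄ .nil))

/-- The subcomplex is simply connected: nonempty, connected, and with trivial edge path group. -/
structure SimplyConnectedComplex (S : Set (ℤ × ℤ)) : Prop where
  nonempty : S.Nonempty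
  connected : ∀ v ∈ vertices S, ∀ w ∈ vertices S, (skeleton S).Reachable v w
  loops : ∀ (v : ℤ × ℤ) (p : (skeleton S).Walk v v), EdgeHomotopic S p .nil

/-- Any two squares of the subcomplex are joined by a chain of squares of the subcomplex in which
consecutive squares have a common side. -/
def SideConnected (S : Set (ℤ × ℤ)) : Prop :=
  ∀ s ∈ S, ∀ t ∈ S, Relation.ReflTransGen
    (fun a b : ℤ × ℤ => b ∈ S ∧ (a.1 - b.1).natAbs + (a.2 - b.2).natAbs = 1) s t

/-! ### Rings and orthogonal ring patterns -/

/-- An assignment of a ring to each vertex: its center, the signed radius `r` of the inner circle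
(negative for the clockwise orientation), and the radius `R` of the outer circle. Only the values
at the vertices of the subcomplex under consideration matter. -/
structure Rings where
  /-- the common center of the two circles -/
  center : ℤ × ℤ → ℂ
  /-- the signed inner radius -/
  r : ℤ × ℤ → ℝ
  /-- the outer radius -/
  R : ℤ × ℤ → ℝ

namespace Rings

variable (P : Rings)

/-- The inner circle (a point if `r = 0`). -/
def inner (v : ℤ × ℤ) : Set ℂ := Metric.sphere (P.center v) |P.r v|

/-- The outer circle. -/
def outer (v : ℤ × ℤ) : Set ℂ := Metric.sphere (P.center v) (P.R v)

/-- The area of the ring at `v`. -/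
noncomputable def area (v : ℤ × ℤ) : ℝ := ((P.R v) ^ 2 - (P.r v) ^ 2) * Real.pi

/-- The circles of the rings `v` and `w` given by the sets `K` and `L` intersect orthogonally: they
have a common point at which their radius vectors (equivalently, their tangents) are perpendicular.
(By reflection in the line of centers the same then holds at every common point.) -/
def CirclesOrthogonal (v w : ℤ × ℤ) (K L : Set ℂ) : Prop :=
  ∃ p ∈ K ∩ L, Inner.inner ℝ (p - P.center v) (p - P.center w) = 0

/-- The rings at `v` and `w` intersect orthogonally: the outer circle of each of them intersects the
inner circle of the other one orthogonally. -/
def RingsOrthogonal (v w : ℤ × ℤ) : Prop :=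
  P.CirclesOrthogonal v w (P.outer v) (P.inner w) ∧
    P.CirclesOrthogonal v w (P.inner v) (P.outer w)

end Rings

/-- Twice the signed area of the triangle `a b c`: positive if `a, b, c` are in counter-clockwise
order, negative if they are in clockwise order. -/
def orient (a b c : ℂ) : ℝ :=
  (b - a).re * (c - a).im - (b - a).im * (c - a).re

/-- The rings at the four corners of the square `s` fit together at the point `q`.

The first four fields say that the two inner circles of one diagonal and the two outer circles of
the other diagonal pass through `q`. The other fields are the orientation condition. As seen from
the center of an inner circle through `q`, the points: center of the next outer circle, `q`, center
of the other outer circle, follow each other in the direction in which that inner circle is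
oriented (counter-clockwise if `r > 0`, clockwise if `r < 0`), and the two outer circles, which are
both positively oriented, touch externally. If `r ≠ 0` for one of the two inner circles, the latter
follows from orthogonality and the other orientation conditions; if both inner circles shrink to
the point `q`, it is what remains of these conditions in the limit `r → 0`. -/
structure FitsAt (P : Rings) (s : ℤ × ℤ) (q : ℂ) : Prop where
  mem_inner_sw : q ∈ P.inner s
  mem_inner_ne : q ∈ P.inner (ne s)
  mem_outer_se : q ∈ P.outer (se s)
  mem_outer_nw : q ∈ P.outer (nw s)
  orient_sw_se : SignType.sign (orient (P.center s) (P.center (se s)) q) = SignType.sign (P.r s)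
  orient_sw_nw : SignType.sign (orient (P.center s) q (P.center (nw s))) = SignType.sign (P.r s)
  orient_ne_nw : SignType.sign (orient (P.center (ne s)) (P.center (nw s)) q) =
    SignType.sign (P.r (ne s))
  orient_ne_se : SignType.sign (orient (P.center (ne s)) q (P.center (se s))) =
    SignType.sign (P.r (ne s))
  outer_touch : dist (P.center (se s)) (P.center (nw s)) = P.R (se s) + P.R (nw s)

/-- Orthogonal ring patterns on the subcomplex given by the set `S` of squares. -/
structure IsOrthogonalRingPattern (S : Set (ℤ × ℤ)) (P : Rings) : Prop where
  outer_pos : ∀ v ∈ vertices S, 0 < P.R v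
  orthogonal : ∀ v w, (skeleton S).Adj v w → P.RingsOrthogonal v w
  fits : ∀ s ∈ S, ∃ q : ℂ, FitsAt P s q

/-- `ρ` are `ρ`-radii of the rings `P`, of constant area `π ℓ ^ 2`. -/
def HasRhoRadii (S : Set (ℤ × ℤ)) (P : Rings) (ℓ : ℝ) (ρ : ℤ × ℤ → ℝ) : Prop :=
  ∀ v ∈ vertices S, P.r v = ℓ * Real.sinh (ρ v) ∧ P.R v = ℓ * Real.cosh (ρ v)

end RingPattern

open RingPattern

namespace RingPattern

open Complex

/-! ### Geometry of a single square -/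

/-! In each square the four centers lie on a cross through `q` with unit direction `u`
(`exists_frame`), so every side, as a vector, is `u * (± cosh a + i sinh b)`, with `a`, `b` the
ρ-radii at its ends (`squareEdges`). Conversely, sides of this form with `‖u‖ = 1` in every square
make a pattern (`isOrthogonalRingPattern_of_squareEdges`).

By the addition theorems, `cosh a + i ε sinh b` is a product of a function of `a + b` and a function
of `a - b`. A shift by `δ` changes only the first, so it multiplies the side by a factor that
depends on `ε` and the mean of `a` and `b`. Two squares sharing a side exchange the roles of `cosh`
and `sinh` at its ends, but the mean is symmetric and `ε` depends only on whether the side is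
horizontal or vertical. Both squares therefore prescribe the same new vector, and each keeps its
`u`. The new vectors close up around every square, so simple connectivity integrates them to
centers.

For uniqueness, the radii and the cross determine a square up to a direct isometry, and a common
side with distinct end centers forces the isometries of adjacent squares to agree. -/

theorem CirclesOrthogonal.normSq_sub {P : Rings} {v w : ℤ × ℤ} {A B : ℝ}
    (h : P.CirclesOrthogonal v w (Metric.sphere (P.center v) A) (Metric.sphere (P.center w) B)) :
    normSq (P.center w - P.center v) = A ^ 2 + B ^ 2 := by
  obtain ⟨p, ⟨hp, hp'⟩, h⟩ := h
  rw [mem_sphere_iff_norm] at hp hp'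
  rw [← hp, ← hp', ← normSq_eq_norm_sq, ← normSq_eq_norm_sq]
  simp only [Complex.inner, normSq_apply, mul_re, conj_re, conj_im, sub_re, sub_im] at h ⊢
  linarith

theorem circlesOrthogonal_of_normSq_sub {P : Rings} {v w : ℤ × ℤ} {A B : ℝ} (hA : 0 ≤ A)
    (hpos : 0 < A ^ 2 + B ^ 2)
    (h : normSq (P.center w - P.center v) = A ^ 2 + B ^ 2) :
    P.CirclesOrthogonal v w (Metric.sphere (P.center v) A) (Metric.sphere (P.center w) |B|) := by
  set d := P.center w - P.center v with hd
  have hw : P.center w = P.center v + d := by rw [hd]; ring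
  set D := A ^ 2 + B ^ 2 with hD
  have hre : d.re ^ 2 + d.im ^ 2 = D := by rw [← h, normSq_apply]; ring
  have hD0 : D ≠ 0 := hpos.ne'
  -- The right triangle over `d` with legs `A` and `|B|` has its apex at `d * (A + i B) * A / D`:
  -- `d` turned by the angle at `v` and scaled to length `A`.
  let x : ℝ := A * (d.re * A - d.im * B) / D
  let y : ℝ := A * (d.re * B + d.im * A) / D
  have hx : x * D = A * (d.re * A - d.im * B) := div_mul_cancel₀ _ hD0
  have hy : y * D = A * (d.re * B + d.im * A) := div_mul_cancel₀ _ hD0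
  have hxy : x ^ 2 + y ^ 2 = A ^ 2 := by
    have : (x ^ 2 + y ^ 2) * D ^ 2 = A ^ 2 * D ^ 2 := by
      calc (x ^ 2 + y ^ 2) * D ^ 2 = (x * D) ^ 2 + (y * D) ^ 2 := by ring
        _ = A ^ 2 * (d.re ^ 2 + d.im ^ 2) * (A ^ 2 + B ^ 2) := by rw [hx, hy]; ring
        _ = A ^ 2 * D ^ 2 := by rw [hre]; ring
    exact mul_right_cancel₀ (pow_ne_zero 2 hD0) this
  have hdot : x * d.re + y * d.im = A ^ 2 := by
    have : (x * d.re + y * d.im) * D = A ^ 2 * D := by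
      calc (x * d.re + y * d.im) * D = (x * D) * d.re + (y * D) * d.im := by ring
        _ = A ^ 2 * (d.re ^ 2 + d.im ^ 2) := by rw [hx, hy]; ring
        _ = A ^ 2 * D := by rw [hre]
    exact mul_right_cancel₀ hD0 this
  refine ⟨P.center v + ⟨x, y⟩, ⟨?_, ?_⟩, ?_⟩
  · rw [mem_sphere_iff_norm, add_sub_cancel_left, ← abs_of_nonneg (norm_nonneg _),
      ← abs_of_nonneg hA, ← sq_eq_sq_iff_abs_eq_abs, ← normSq_eq_norm_sq, normSq_apply, ← hxy]
    ring
  · rw [mem_sphere_iff_norm, hw, ← abs_of_nonneg (norm_nonneg _), ← sq_eq_sq_iff_abs_eq_abs,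
      ← normSq_eq_norm_sq, normSq_apply]
    simp only [sub_re, sub_im, add_re, add_im]
    linear_combination hxy - 2 * hdot + hre + hD
  · rw [hw]
    simp only [Complex.inner, mul_re, conj_re, conj_im, sub_re, sub_im, add_re, add_im]
    linear_combination hxy - hdot

/-- The centers of the rings at the corners of `s` lie on two perpendicular lines through `q`, one
of them with direction `u`, at the signed distances given by the radii. -/
structure HasFrame (P : Rings) (s : ℤ × ℤ) (q u : ℂ) : Prop where
  norm_eq : ‖u‖ = 1
  sw : P.center s = q - u * (P.r s * I)
  se : P.center (se s) = q + u * P.R (se s)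
  ne : P.center (ne s) = q + u * (P.r (ne s) * I)
  nw : P.center (nw s) = q - u * P.R (nw s)

theorem eq_of_sq_eq_of_sign_eq {a b : ℝ} (h : a ^ 2 = b ^ 2)
    (hs : SignType.sign a = SignType.sign b) : a = b := by
  rw [← sign_mul_abs a, ← sign_mul_abs b, hs, (sq_eq_sq_iff_abs_eq_abs a b).1 h]

theorem sign_eq_of_eq_mul {x a b : ℝ} (ha : 0 < a) (h : x = a * b) :
    SignType.sign x = SignType.sign b := by
  rw [h, sign_mul, sign_pos ha, one_mul]

theorem HasFrame.fitsAt {P : Rings} {s : ℤ × ℤ} {q u : ℂ} (h : HasFrame P s q u)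
    (hse : 0 < P.R (RingPattern.se s)) (hnw : 0 < P.R (RingPattern.nw s)) : FitsAt P s q := by
  have hu : u.re ^ 2 + u.im ^ 2 = 1 := by
    have := normSq_eq_norm_sq u
    rw [h.norm_eq, normSq_apply] at this
    linarith
  constructor
  · simp [Rings.inner, h.sw, h.norm_eq]
  · simp [Rings.inner, h.ne, h.norm_eq]
  · simp [Rings.outer, h.se, h.norm_eq, abs_of_pos hse]
  · simp [Rings.outer, h.nw, h.norm_eq, abs_of_pos hnw]
  · refine sign_eq_of_eq_mul hse ?_
    rw [h.sw, h.se]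
    simp [orient]
    linear_combination (P.R (RingPattern.se s) * P.r s) * hu
  · refine sign_eq_of_eq_mul hnw ?_
    rw [h.sw, h.nw]
    simp [orient]
    linear_combination (P.R (RingPattern.nw s) * P.r s) * hu
  · refine sign_eq_of_eq_mul hnw ?_
    rw [h.ne, h.nw]
    simp [orient]
    linear_combination (P.R (RingPattern.nw s) * P.r (RingPattern.ne s)) * hu
  · refine sign_eq_of_eq_mul hse ?_
    rw [h.ne, h.se]
    simp [orient]
    linear_combination (P.R (RingPattern.se s) * P.r (RingPattern.ne s)) * hu
  · rw [h.se, h.nw, dist_eq_norm]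
    have : q + u * P.R (RingPattern.se s) - (q - u * P.R (RingPattern.nw s)) =
        u * ((P.R (RingPattern.se s) + P.R (RingPattern.nw s) : ℝ) : ℂ) := by push_cast; ring
    rw [this, norm_mul, h.norm_eq, one_mul, norm_real, Real.norm_of_nonneg (by positivity)]

/-- A point at distance `|r|` from `q` which sees `q` and a point `q + R u` at a right angle at `q`
is determined by its orientation. -/
theorem eq_add_of_orient {c q u : ℂ} {R r ε : ℝ} (hu : ‖u‖ = 1) (hR : 0 < R) (hε : ε ^ 2 = 1)
    (hq : normSq (c - q) = r ^ 2) (hc : normSq (q + u * R - c) = R ^ 2 + r ^ 2)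
    (ho : SignType.sign (ε * orient c q (q + u * R)) = SignType.sign r) :
    c = q + u * ((ε * r : ℝ) * I) := by
  have hu : u.re ^ 2 + u.im ^ 2 = 1 := by
    have := normSq_eq_norm_sq u
    rw [hu, normSq_apply] at this
    linarith
  -- Coordinates of `c - q` in the orthonormal basis `u`, `i u`. Pythagoras gives `x = 0`, and the
  -- orientation then fixes the sign of `y`.
  set x := (c - q).re * u.re + (c - q).im * u.im with hx
  set y := (c - q).im * u.re - (c - q).re * u.im with hy
  simp only [normSq_apply, sub_re, sub_im, add_re, add_im, mul_re, mul_im, ofReal_re,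
    ofReal_im, mul_zero, sub_zero, zero_add] at hq hc hx hy
  have hx0 : x = 0 := by
    have : R * x = 0 := by
      rw [hx]
      linear_combination (1 / 2) * hq - (1 / 2) * hc + (R ^ 2 / 2) * hu
    exact (mul_eq_zero.1 this).resolve_left hR.ne'
  have hxy : x ^ 2 + y ^ 2 = r ^ 2 := by
    rw [hx, hy]
    linear_combination hq + ((c.re - q.re) ^ 2 + (c.im - q.im) ^ 2) * hu
  have hor : ε * orient c q (q + u * R) = R * (ε * y) := by
    rw [hy]
    simp [orient]
    ring
  rw [sign_eq_of_eq_mul hR hor] at ho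
  have hyr : ε * y = r := by
    refine eq_of_sq_eq_of_sign_eq ?_ ho
    rw [mul_pow, hε, one_mul, ← hxy, hx0]
    ring
  have hyr' : y = ε * r := by rw [← hyr, ← mul_assoc, ← sq, hε, one_mul]
  rw [← hyr']
  apply Complex.ext
  · simp
    linear_combination (q.re - c.re) * hu + u.im * hy + u.re * hx0 - u.re * hx
  · simp
    linear_combination (q.im - c.im) * hu - u.re * hy + u.im * hx0 - u.im * hx

theorem skeleton_adj_of_isEdge {S : Set (ℤ × ℤ)} {v w : ℤ × ℤ} (h : IsEdge S v w) :
    (skeleton S).Adj v w := by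
  rw [skeleton, SimpleGraph.fromRel_adj]
  refine ⟨?_, Or.inl h⟩
  rintro rfl
  obtain ⟨s, -, h | h | h | h⟩ := h <;> simp [RingPattern.se, RingPattern.nw, RingPattern.ne,
    Prod.ext_iff] at h <;> omega

theorem IsOrthogonalRingPattern.exists_frame {S : Set (ℤ × ℤ)} {P : Rings}
    (hP : IsOrthogonalRingPattern S P) {s : ℤ × ℤ} (hs : s ∈ S) : ∃ q u, HasFrame P s q u := by
  obtain ⟨q, hq⟩ := hP.fits s hs
  have hse : 0 < P.R (se s) := hP.outer_pos _ ⟨s, hs, by simp⟩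
  have hnw : 0 < P.R (nw s) := hP.outer_pos _ ⟨s, hs, by simp⟩
  have h2 := hq.mem_outer_se
  have h4 := hq.mem_outer_nw
  have h1 := hq.mem_inner_sw
  have h3 := hq.mem_inner_ne
  rw [Rings.outer, Metric.mem_sphere, dist_comm, dist_eq_norm] at h2 h4
  rw [Rings.inner, Metric.mem_sphere, dist_comm, dist_eq_norm] at h1 h3
  have h1' : normSq (P.center s - q) = P.r s ^ 2 := by rw [normSq_eq_norm_sq, h1, sq_abs]
  have h3' : normSq (P.center (ne s) - q) = P.r (ne s) ^ 2 := by
    rw [normSq_eq_norm_sq, h3, sq_abs]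
  have hse' : (P.R (se s) : ℂ) ≠ 0 := by exact_mod_cast hse.ne'
  set u : ℂ := (P.center (se s) - q) / P.R (se s) with hu
  have hu1 : ‖u‖ = 1 := by
    rw [hu, norm_div, h2, norm_real, Real.norm_of_nonneg hse.le, div_self hse.ne']
  have hcse : P.center (se s) = q + u * P.R (se s) := by
    rw [hu, div_mul_cancel₀ _ hse']; ring
  have hcnw : P.center (nw s) = q - u * P.R (nw s) := by
    have ht := hq.outer_touch
    -- External tangency is equality in the triangle inequality, so `q` lies between the two
    -- centers. This also covers vanishing inner radii.
    have hray : SameRay ℝ (P.center (se s) - q) (q - P.center (nw s)) := by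
      rw [sameRay_iff_norm_add, norm_sub_rev q, h2, h4, ← ht, dist_eq_norm]
      congr 1
      ring
    have := hray.norm_smul_eq
    rw [norm_sub_rev q, h2, h4] at this
    simp only [real_smul] at this
    rw [hu]
    field_simp
    linear_combination -this
  have e12 : normSq (P.center (se s) - P.center s) = P.R (se s) ^ 2 + P.r s ^ 2 := by
    have := CirclesOrthogonal.normSq_sub
      (hP.orthogonal s (se s) (skeleton_adj_of_isEdge ⟨s, hs, by simp⟩)).2
    rw [this, sq_abs, add_comm]
  have e32 : normSq (P.center (se s) - P.center (ne s)) = P.R (se s) ^ 2 + P.r (ne s) ^ 2 := by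
    have := CirclesOrthogonal.normSq_sub
      (hP.orthogonal (ne s) (se s) (skeleton_adj_of_isEdge ⟨s, hs, by simp⟩).symm).2
    rw [this, sq_abs, add_comm]
  refine ⟨q, u, hu1, ?_, hcse, ?_, hcnw⟩
  · rw [eq_add_of_orient (ε := -1) hu1 hse (by norm_num) h1' (hcse ▸ e12) ?_]
    · push_cast; ring
    · rw [← hq.orient_sw_se, ← hcse]
      congr 1
      simp only [orient]
      ring
  · rw [eq_add_of_orient (ε := 1) hu1 hse (by norm_num) h3' (hcse ▸ e32) ?_]
    · simp
    · rw [← hq.orient_ne_se, ← hcse, one_mul]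

/-! ### Deformation of the edge vectors -/

/-- `cosh t + i ε sinh t`. -/
noncomputable def coshSinh (ε t : ℝ) : ℂ := ⟨Real.cosh t, ε * Real.sinh t⟩

theorem coshSinh_ne_zero (ε t : ℝ) : coshSinh ε t ≠ 0 := fun h =>
  (Real.cosh_pos t).ne' (congrArg re h)

theorem continuous_coshSinh (ε t : ℝ) : Continuous fun δ => coshSinh ε (t + δ) := by
  have : (fun δ => coshSinh ε (t + δ)) =
      fun δ => (Real.cosh (t + δ) : ℂ) + (ε * Real.sinh (t + δ) : ℝ) * I := by
    funext δ
    exact mk_eq_add_mul_I _ _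
  rw [this]
  fun_prop

/-- Addition theorems for `cosh (x + y)` and `sinh (x - y)`, with `x` the mean and `y` the half
difference. A common shift of `a` and `b` leaves `y` fixed. -/
theorem cosh_add_sinh_mul_I (ε a b : ℝ) (hε : ε ^ 2 = 1) :
    (⟨Real.cosh a, ε * Real.sinh b⟩ : ℂ) =
      coshSinh ε ((a + b) / 2) * coshSinh (-ε) ((a - b) / 2) := by
  have ha : a = (a + b) / 2 + (a - b) / 2 := by ring
  have hb : b = (a + b) / 2 - (a - b) / 2 := by ring
  apply Complex.ext
  · simp only [coshSinh, mul_re]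
    conv_lhs => rw [ha, Real.cosh_add]
    linear_combination -(Real.sinh ((a + b) / 2) * Real.sinh ((a - b) / 2)) * hε
  · simp only [coshSinh, mul_im]
    conv_lhs => rw [hb, Real.sinh_sub]
    ring

/-- The factor by which an edge vector changes when the `ρ`-radii at its endpoints, of mean `p`,
are shifted by `δ`. -/
noncomputable def shiftFactor (ε p δ : ℝ) : ℂ := coshSinh ε (p + δ) / coshSinh ε p

theorem shiftFactor_zero (ε p : ℝ) : shiftFactor ε p 0 = 1 := by
  rw [shiftFactor, add_zero, div_self (coshSinh_ne_zero ε p)]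

theorem mul_shiftFactor (ε a b δ : ℝ) (hε : ε ^ 2 = 1) :
    (⟨Real.cosh a, ε * Real.sinh b⟩ : ℂ) * shiftFactor ε ((a + b) / 2) δ =
      ⟨Real.cosh (a + δ), ε * Real.sinh (b + δ)⟩ := by
  rw [cosh_add_sinh_mul_I ε a b hε, cosh_add_sinh_mul_I ε (a + δ) (b + δ) hε, shiftFactor]
  have h1 : (a + δ + (b + δ)) / 2 = (a + b) / 2 + δ := by ring
  have h2 : (a + δ - (b + δ)) / 2 = (a - b) / 2 := by ring
  rw [h1, h2]
  have := coshSinh_ne_zero ε ((a + b) / 2)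
  field_simp

/-- `1` for horizontal edges and `-1` for vertical edges. -/
def edgeSign (v w : ℤ × ℤ) : ℝ := if v.2 = w.2 then 1 else -1

/-- The edge vectors of the pattern with shifted `ρ`-radii. -/
noncomputable def shiftedEdge (P : Rings) (ρ : ℤ × ℤ → ℝ) (δ : ℝ) (v w : ℤ × ℤ) : ℂ :=
  (P.center w - P.center v) * shiftFactor (edgeSign v w) ((ρ v + ρ w) / 2) δ

theorem shiftedEdge_swap (P : Rings) (ρ : ℤ × ℤ → ℝ) (δ : ℝ) (v w : ℤ × ℤ) :
    shiftedEdge P ρ δ w v = -shiftedEdge P ρ δ v w := by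
  have : edgeSign w v = edgeSign v w := by simp only [edgeSign, eq_comm]
  rw [shiftedEdge, shiftedEdge, this, add_comm (ρ w)]
  ring

theorem shiftedEdge_zero (P : Rings) (ρ : ℤ × ℤ → ℝ) (v w : ℤ × ℤ) :
    shiftedEdge P ρ 0 v w = P.center w - P.center v := by
  rw [shiftedEdge, shiftFactor_zero, mul_one]

theorem continuous_shiftedEdge (P : Rings) (ρ : ℤ × ℤ → ℝ) (v w : ℤ × ℤ) :
    Continuous fun δ => shiftedEdge P ρ δ v w :=
  continuous_const.mul ((continuous_coshSinh _ _).div_const _)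

/-- The edge vectors around a square with direction `u`, for `ρ`-radii `ρ`. -/
structure SquareEdges (ρ : ℤ × ℤ → ℝ) (s : ℤ × ℤ) (u : ℂ) (α : ℤ × ℤ → ℤ × ℤ → ℂ) : Prop where
  bottom : α s (se s) = u * ⟨Real.cosh (ρ (se s)), Real.sinh (ρ s)⟩
  right : α (se s) (ne s) = u * ⟨-Real.cosh (ρ (se s)), Real.sinh (ρ (ne s))⟩
  left : α s (nw s) = u * ⟨-Real.cosh (ρ (nw s)), Real.sinh (ρ s)⟩
  top : α (nw s) (ne s) = u * ⟨Real.cosh (ρ (nw s)), Real.sinh (ρ (ne s))⟩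

/-- The `cosh` terms cancel along either path, leaving `i u (sinh (ρ s) + sinh (ρ (ne s)))`,
whatever `ρ` is. -/
theorem SquareEdges.closed {ρ : ℤ × ℤ → ℝ} {s : ℤ × ℤ} {u : ℂ} {α : ℤ × ℤ → ℤ × ℤ → ℂ}
    (h : SquareEdges ρ s u α) : α s (se s) + α (se s) (ne s) = α s (nw s) + α (nw s) (ne s) := by
  rw [h.bottom, h.right, h.left, h.top, ← mul_add, ← mul_add]
  congr 1
  apply Complex.ext <;> simp

theorem HasRhoRadii.squareEdges {S : Set (ℤ × ℤ)} {P : Rings} {ρ : ℤ × ℤ → ℝ}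
    (hρ : HasRhoRadii S P 1 ρ) {s : ℤ × ℤ} (hs : s ∈ S) {q u : ℂ} (h : HasFrame P s q u) :
    SquareEdges ρ s u (fun v w => P.center w - P.center v) := by
  have h1 := (hρ s ⟨s, hs, by simp⟩).1
  have h2 := (hρ (se s) ⟨s, hs, by simp⟩).2
  have h3 := (hρ (ne s) ⟨s, hs, by simp⟩).1
  have h4 := (hρ (nw s) ⟨s, hs, by simp⟩).2
  constructor <;> simp only [h.sw, h.se, h.ne, h.nw, h1, h2, h3, h4, one_mul] <;>
    apply Complex.ext <;> simp [-ofReal_cosh, -ofReal_sinh] <;> ring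

theorem SquareEdges.shift {ρ : ℤ × ℤ → ℝ} {s : ℤ × ℤ} {u : ℂ} {P : Rings}
    (h : SquareEdges ρ s u (fun v w => P.center w - P.center v)) (δ : ℝ) :
    SquareEdges (fun v => ρ v + δ) s u (shiftedEdge P ρ δ) := by
  have key₁ : ∀ a b : ℝ, (⟨Real.cosh a, Real.sinh b⟩ : ℂ) * shiftFactor 1 ((a + b) / 2) δ =
      ⟨Real.cosh (a + δ), Real.sinh (b + δ)⟩ := fun a b => by
    simpa using mul_shiftFactor 1 a b δ (by norm_num)
  have neg_mk : ∀ a b : ℝ, (⟨-a, b⟩ : ℂ) = -⟨a, -1 * b⟩ := fun a b => by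
    apply Complex.ext <;> simp
  have key₂ : ∀ a b : ℝ, (⟨-Real.cosh a, Real.sinh b⟩ : ℂ) * shiftFactor (-1) ((a + b) / 2) δ =
      ⟨-Real.cosh (a + δ), Real.sinh (b + δ)⟩ := fun a b => by
    rw [neg_mk, neg_mk, neg_mul, mul_shiftFactor (-1) a b δ (by norm_num)]
  have e1 : edgeSign s (se s) = 1 := by simp [edgeSign, se]
  have e2 : edgeSign (se s) (ne s) = -1 := by simp [edgeSign, se, ne]
  have e3 : edgeSign s (nw s) = -1 := by simp [edgeSign, nw]
  have e4 : edgeSign (nw s) (ne s) = 1 := by simp [edgeSign, nw, ne]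
  constructor
  · rw [shiftedEdge, h.bottom, e1, mul_assoc, add_comm (ρ s), key₁]
  · rw [shiftedEdge, h.right, e2, mul_assoc, key₂]
  · rw [shiftedEdge, h.left, e3, mul_assoc, add_comm (ρ s), key₂]
  · rw [shiftedEdge, h.top, e4, mul_assoc, key₁]

theorem SquareEdges.hasFrame {ρ : ℤ × ℤ → ℝ} {s : ℤ × ℤ} {u : ℂ} {P : Rings}
    (hu : ‖u‖ = 1) (h : SquareEdges ρ s u (fun v w => P.center w - P.center v))
    (hr : ∀ v, P.r v = Real.sinh (ρ v)) (hR : ∀ v, P.R v = Real.cosh (ρ v)) :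
    HasFrame P s (P.center s + u * (P.r s * I)) u := by
  have h1 := sub_eq_iff_eq_add'.1 h.bottom
  have h3 := sub_eq_iff_eq_add'.1 h.right
  have h4 := sub_eq_iff_eq_add'.1 h.left
  refine ⟨hu, by ring, ?_, ?_, ?_⟩
  · rw [h1, hr, hR]
    apply Complex.ext <;> simp [-ofReal_cosh, -ofReal_sinh] <;> ring
  · rw [h3, h1, hr, hr]
    apply Complex.ext <;> simp [-ofReal_cosh, -ofReal_sinh] <;> ring
  · rw [h4, hr, hR]
    apply Complex.ext <;> simp [-ofReal_cosh, -ofReal_sinh] <;> ring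

theorem SquareEdges.normSq_edge {S : Set (ℤ × ℤ)} {ρ : ℤ × ℤ → ℝ} {P : Rings}
    (h : ∀ s ∈ S, ∃ u : ℂ, ‖u‖ = 1 ∧ SquareEdges ρ s u (fun v w => P.center w - P.center v))
    {v w : ℤ × ℤ} (hvw : (skeleton S).Adj v w) :
    normSq (P.center w - P.center v) = Real.cosh (ρ v) ^ 2 + Real.sinh (ρ w) ^ 2 := by
  rw [skeleton, SimpleGraph.fromRel_adj] at hvw
  wlog hE : IsEdge S v w generalizing v w
  -- Equal areas make the formula symmetric: `cosh² a + sinh² b = sinh² a + cosh² b`.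
  · have := this ⟨hvw.1.symm, hvw.2.symm⟩ (hvw.2.resolve_left hE)
    rw [← neg_sub, normSq_neg, this, Real.cosh_sq, Real.cosh_sq]
    ring
  obtain ⟨s, hs, hE⟩ := hE
  obtain ⟨u, hu, h⟩ := h s hs
  have hu' : normSq u = 1 := by rw [normSq_eq_norm_sq, hu, one_pow]
  rcases hE with ⟨rfl, rfl⟩ | ⟨rfl, rfl⟩ | ⟨rfl, rfl⟩ | ⟨rfl, rfl⟩
  · rw [h.bottom, normSq_mul, hu', normSq_mk, ← sq, ← sq, Real.cosh_sq, Real.cosh_sq]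
    ring
  · rw [h.top, normSq_mul, hu', normSq_mk]
    ring
  · rw [h.left, normSq_mul, hu', normSq_mk, neg_mul_neg, ← sq, ← sq, Real.cosh_sq, Real.cosh_sq]
    ring
  · rw [h.right, normSq_mul, hu', normSq_mk]
    ring

theorem isOrthogonalRingPattern_of_squareEdges {S : Set (ℤ × ℤ)} {ρ : ℤ × ℤ → ℝ} {P : Rings}
    (h : ∀ s ∈ S, ∃ u : ℂ, ‖u‖ = 1 ∧ SquareEdges ρ s u (fun v w => P.center w - P.center v))
    (hr : ∀ v, P.r v = Real.sinh (ρ v)) (hR : ∀ v, P.R v = Real.cosh (ρ v)) :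
    IsOrthogonalRingPattern S P := by
  have hpos : ∀ v, 0 < P.R v := fun v => by rw [hR]; exact Real.cosh_pos _
  have horth : ∀ v w, (skeleton S).Adj v w →
      P.CirclesOrthogonal v w (P.outer v) (P.inner w) := fun v w hvw => by
    have := hpos v
    refine circlesOrthogonal_of_normSq_sub this.le (by positivity) ?_
    rw [SquareEdges.normSq_edge h hvw, hr, hR]
  refine ⟨fun v _ => hpos v, fun v w hvw => ⟨horth v w hvw, ?_⟩, fun s hs => ?_⟩
  · obtain ⟨p, ⟨h1, h2⟩, h3⟩ := horth w v hvw.symm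
    exact ⟨p, ⟨h2, h1⟩, by rw [real_inner_comm]; exact h3⟩
  · obtain ⟨u, hu, h⟩ := h s hs
    exact ⟨_, (h.hasFrame hu hr hR).fitsAt (hpos _) (hpos _)⟩

/-! ### Integration of closed edge forms -/

/-- The sum of an edge form along a walk. -/
def walkSum {S : Set (ℤ × ℤ)} (α : ℤ × ℤ → ℤ × ℤ → ℂ) {v w : ℤ × ℤ}
    (p : (skeleton S).Walk v w) : ℂ :=
  (p.darts.map fun d => α d.fst d.snd).sum

section walkSum

variable {S : Set (ℤ × ℤ)} {α : ℤ × ℤ → ℤ × ℤ → ℂ}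

theorem walkSum_nil (v : ℤ × ℤ) : walkSum α (.nil : (skeleton S).Walk v v) = 0 := by
  simp [walkSum]

theorem walkSum_cons {v w x : ℤ × ℤ} (h : (skeleton S).Adj v w) (p : (skeleton S).Walk w x) :
    walkSum α (.cons h p) = α v w + walkSum α p := by
  simp [walkSum]

theorem walkSum_append {v w x : ℤ × ℤ} (p : (skeleton S).Walk v w) (q : (skeleton S).Walk w x) :
    walkSum α (p.append q) = walkSum α p + walkSum α q := by
  simp [walkSum]

/-- Antisymmetry takes care of backtracking, and closedness of pushing across a square. -/
theorem EdgeHomotopic.walkSum_eq (hswap : ∀ v w, α w v = -α v w)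
    (hclosed : ∀ s ∈ S, α s (se s) + α (se s) (ne s) = α s (nw s) + α (nw s) (ne s))
    {v w : ℤ × ℤ} {p q : (skeleton S).Walk v w} (h : EdgeHomotopic S p q) :
    walkSum α p = walkSum α q := by
  induction h with
  | refl p => rfl
  | symm _ ih => exact ih.symm
  | trans _ _ ih₁ ih₂ => exact ih₁.trans ih₂
  | append _ _ ih₁ ih₂ => rw [walkSum_append, walkSum_append, ih₁, ih₂]
  | @backtrack v w h h' =>
    rw [walkSum_cons, walkSum_cons, walkSum_nil, hswap v w, add_zero, add_neg_cancel]
  | square hs => simpa [walkSum_cons, walkSum_nil] using hclosed _ hs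

theorem SimplyConnectedComplex.walkSum_eq (hS : SimplyConnectedComplex S)
    (hswap : ∀ v w, α w v = -α v w)
    (hclosed : ∀ s ∈ S, α s (se s) + α (se s) (ne s) = α s (nw s) + α (nw s) (ne s))
    {v w : ℤ × ℤ} (p q : (skeleton S).Walk v w) : walkSum α p = walkSum α q := by
  have hp := (hS.loops v (p.append q.reverse)).walkSum_eq hswap hclosed
  have hq := (hS.loops v (q.append q.reverse)).walkSum_eq hswap hclosed
  rw [walkSum_append] at hp hq
  exact add_right_cancel (hp.trans hq.symm)

theorem walkSum_sub (f : ℤ × ℤ → ℂ) {v w : ℤ × ℤ} (p : (skeleton S).Walk v w) :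
    walkSum (fun x y => f y - f x) p = f w - f v := by
  induction p with
  | nil => simp [walkSum_nil]
  | cons h p ih => rw [walkSum_cons, ih]; ring

theorem continuous_walkSum {α : ℝ → ℤ × ℤ → ℤ × ℤ → ℂ} (hα : ∀ v w, Continuous fun δ => α δ v w)
    {v w : ℤ × ℤ} (p : (skeleton S).Walk v w) : Continuous fun δ => walkSum (α δ) p := by
  induction p with
  | nil => simpa only [walkSum_nil] using continuous_const
  | cons h p ih => simp only [walkSum_cons]; exact (hα _ _).add ih

/-- The potential of a closed edge form that vanishes at `o`. -/
noncomputable def potential (S : Set (ℤ × ℤ)) (α : ℤ × ℤ → ℤ × ℤ → ℂ) (o v : ℤ × ℤ) : ℂ :=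
  open Classical in if h : (skeleton S).Reachable o v then walkSum α h.some else 0

theorem potential_of_reachable {o v : ℤ × ℤ} (h : (skeleton S).Reachable o v) :
    potential S α o v = walkSum α h.some := dif_pos h

theorem SimplyConnectedComplex.potential_sub (hS : SimplyConnectedComplex S)
    (hswap : ∀ v w, α w v = -α v w)
    (hclosed : ∀ s ∈ S, α s (se s) + α (se s) (ne s) = α s (nw s) + α (nw s) (ne s))
    {o v w : ℤ × ℤ} (ho : (skeleton S).Reachable o v) (hvw : (skeleton S).Adj v w) :
    potential S α o w - potential S α o v = α v w := by
  rw [potential_of_reachable ho, potential_of_reachable (ho.trans hvw.reachable),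
    hS.walkSum_eq hswap hclosed _ (ho.some.append (.cons hvw .nil)), walkSum_append, walkSum_cons,
    walkSum_nil]
  ring

end walkSum

/-! ### The deformation -/

/-- The rings with `ρ`-radii shifted by `δ`; the ring at `o` keeps its center. -/
noncomputable def shiftedRings (S : Set (ℤ × ℤ)) (P : Rings) (ρ : ℤ × ℤ → ℝ) (o : ℤ × ℤ)
    (δ : ℝ) : Rings where
  center v := P.center o + potential S (shiftedEdge P ρ δ) o v
  r v := Real.sinh (ρ v + δ)
  R v := Real.cosh (ρ v + δ)

theorem isOrthogonalRingPattern_shiftedRings {S : Set (ℤ × ℤ)} (hS : SimplyConnectedComplex S)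
    {P : Rings} (hP : IsOrthogonalRingPattern S P) {ρ : ℤ × ℤ → ℝ} (hρ : HasRhoRadii S P 1 ρ)
    {o : ℤ × ℤ} (ho : o ∈ vertices S) (δ : ℝ) :
    IsOrthogonalRingPattern S (shiftedRings S P ρ o δ) := by
  have hedges : ∀ s ∈ S, ∃ u : ℂ, ‖u‖ = 1 ∧
      SquareEdges (fun v => ρ v + δ) s u (shiftedEdge P ρ δ) := fun s hs => by
    obtain ⟨q, u, h⟩ := hP.exists_frame hs
    exact ⟨u, h.norm_eq, (hρ.squareEdges hs h).shift δ⟩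
  have hclosed : ∀ s ∈ S, shiftedEdge P ρ δ s (se s) + shiftedEdge P ρ δ (se s) (ne s) =
      shiftedEdge P ρ δ s (nw s) + shiftedEdge P ρ δ (nw s) (ne s) := fun s hs => by
    obtain ⟨u, -, h⟩ := hedges s hs
    exact h.closed
  have hsub : ∀ {v w}, v ∈ vertices S → IsEdge S v w →
      (shiftedRings S P ρ o δ).center w - (shiftedRings S P ρ o δ).center v =
        shiftedEdge P ρ δ v w := fun {v w} hv hvw => by
    simp only [shiftedRings, add_sub_add_left_eq_sub]
    exact hS.potential_sub (shiftedEdge_swap P ρ δ) hclosed (hS.connected o ho v hv)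
      (skeleton_adj_of_isEdge hvw)
  refine isOrthogonalRingPattern_of_squareEdges (ρ := fun v => ρ v + δ) (fun s hs => ?_)
    (fun _ => rfl) (fun _ => rfl)
  obtain ⟨u, hu, h⟩ := hedges s hs
  refine ⟨u, hu, ?_, ?_, ?_, ?_⟩
  · rw [← h.bottom]
    exact hsub ⟨s, hs, by simp⟩ ⟨s, hs, by simp⟩
  · rw [← h.right]
    exact hsub ⟨s, hs, by simp⟩ ⟨s, hs, by simp⟩
  · rw [← h.left]
    exact hsub ⟨s, hs, by simp⟩ ⟨s, hs, by simp⟩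
  · rw [← h.top]
    exact hsub ⟨s, hs, by simp⟩ ⟨s, hs, by simp⟩

/-! ### Uniqueness -/

/-- The corners of the square `s`. -/
def IsCorner (s v : ℤ × ℤ) : Prop := v = s ∨ v = se s ∨ v = ne s ∨ v = nw s

theorem HasRhoRadii.exists_isometry_square {S : Set (ℤ × ℤ)} {Q Q' : Rings} {ρ : ℤ × ℤ → ℝ}
    (hQ : IsOrthogonalRingPattern S Q) (hQρ : HasRhoRadii S Q 1 ρ)
    (hQ' : IsOrthogonalRingPattern S Q') (hQρ' : HasRhoRadii S Q' 1 ρ) {s : ℤ × ℤ} (hs : s ∈ S) :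
    ∃ a b : ℂ, ‖a‖ = 1 ∧ ∀ v, IsCorner s v → Q'.center v = a * Q.center v + b := by
  obtain ⟨q, u, h⟩ := hQ.exists_frame hs
  obtain ⟨q', u', h'⟩ := hQ'.exists_frame hs
  have hu : u ≠ 0 := fun h0 => by simpa [h0] using h.norm_eq
  have hrad : ∀ v, IsCorner s v → Q'.r v = Q.r v ∧ Q'.R v = Q.R v := fun v hv => by
    have h1 := hQρ v ⟨s, hs, hv⟩
    have h2 := hQρ' v ⟨s, hs, hv⟩
    exact ⟨h2.1.trans h1.1.symm, h2.2.trans h1.2.symm⟩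
  -- The direct isometry carrying the cross `(q, u)` to the cross `(q', u')`.
  refine ⟨u' / u, q' - u' / u * q, by rw [norm_div, h.norm_eq, h'.norm_eq, div_one], ?_⟩
  intro v hv
  obtain ⟨hr, hR⟩ := hrad v hv
  rcases hv with rfl | rfl | rfl | rfl
  · rw [h.sw, h'.sw, hr]; field_simp; ring
  · rw [h.se, h'.se, hR]; field_simp; ring
  · rw [h.ne, h'.ne, hr]; field_simp; ring
  · rw [h.nw, h'.nw, hR]; field_simp; ring

theorem HasRhoRadii.center_ne {S : Set (ℤ × ℤ)} {Q : Rings} {ρ : ℤ × ℤ → ℝ}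
    (hQ : IsOrthogonalRingPattern S Q) (hQρ : HasRhoRadii S Q 1 ρ) {v w : ℤ × ℤ}
    (h : (skeleton S).Adj v w) : Q.center v ≠ Q.center w := by
  intro heq
  have := SquareEdges.normSq_edge (S := S) (ρ := ρ) (P := Q) (fun s hs => by
    obtain ⟨q, u, h⟩ := hQ.exists_frame hs
    exact ⟨u, h.norm_eq, hQρ.squareEdges hs h⟩) h
  rw [heq, sub_self, map_zero] at this
  exact absurd this (by positivity : 0 < Real.cosh (ρ v) ^ 2 + Real.sinh (ρ w) ^ 2).ne

/-- Squares with a common side share the two endpoints of an edge. -/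
theorem exists_common_edge {S : Set (ℤ × ℤ)} {s t : ℤ × ℤ} (ht : t ∈ S)
    (h : (s.1 - t.1).natAbs + (s.2 - t.2).natAbs = 1) :
    ∃ v w, IsEdge S v w ∧ IsCorner s v ∧ IsCorner s w ∧ IsCorner t v ∧ IsCorner t w := by
  obtain ⟨m, n⟩ := s
  obtain ⟨k, l⟩ := t
  simp only at h
  have : (k = m + 1 ∧ l = n) ∨ (k = m - 1 ∧ l = n) ∨ (k = m ∧ l = n + 1) ∨ (k = m ∧ l = n - 1) := by
    omega
  rcases this with ⟨rfl, rfl⟩ | ⟨rfl, rfl⟩ | ⟨rfl, rfl⟩ | ⟨rfl, rfl⟩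
  · exact ⟨_, _, ⟨_, ht, Or.inr (Or.inr (Or.inl ⟨rfl, rfl⟩))⟩, by simp [IsCorner, se, nw, ne]⟩
  · exact ⟨_, _, ⟨_, ht, Or.inr (Or.inr (Or.inr ⟨rfl, rfl⟩))⟩, by simp [IsCorner, se, nw, ne]⟩
  · exact ⟨_, _, ⟨_, ht, Or.inl ⟨rfl, rfl⟩⟩, by simp [IsCorner, se, nw, ne]⟩
  · exact ⟨_, _, ⟨_, ht, Or.inr (Or.inl ⟨rfl, rfl⟩)⟩, by simp [IsCorner, se, nw, ne]⟩

theorem HasRhoRadii.exists_isometry {S : Set (ℤ × ℤ)} (hne : S.Nonempty) (hS : SideConnected S)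
    {Q Q' : Rings} {ρ : ℤ × ℤ → ℝ}
    (hQ : IsOrthogonalRingPattern S Q) (hQρ : HasRhoRadii S Q 1 ρ)
    (hQ' : IsOrthogonalRingPattern S Q') (hQρ' : HasRhoRadii S Q' 1 ρ) :
    ∃ a b : ℂ, ‖a‖ = 1 ∧ ∀ v ∈ vertices S, Q'.center v = a * Q.center v + b := by
  obtain ⟨s, hs⟩ := hne
  obtain ⟨a, b, ha, hab⟩ := HasRhoRadii.exists_isometry_square hQ hQρ hQ' hQρ' hs
  refine ⟨a, b, ha, ?_⟩
  rintro v ⟨t, ht, hv⟩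
  have hst := hS s hs t ht
  clear ht
  suffices ∀ v, IsCorner t v → Q'.center v = a * Q.center v + b from this v hv
  clear hv v
  induction hst with
  | refl => exact hab
  | @tail x y _ hxy ih =>
    obtain ⟨hy, hxy⟩ := hxy
    obtain ⟨v, w, he, hxv, hxw, hyv, hyw⟩ := exists_common_edge hy hxy
    obtain ⟨a', b', -, hab'⟩ := HasRhoRadii.exists_isometry_square hQ hQρ hQ' hQρ' hy
    have hne := sub_ne_zero.2 (hQρ.center_ne hQ (skeleton_adj_of_isEdge he))
    have e1 := (ih v hxv).symm.trans (hab' v hyv)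
    have e2 := (ih w hxw).symm.trans (hab' w hyw)
    -- Two maps `z ↦ a z + b` that agree at two distinct points coincide.
    have haa : a = a' := mul_right_cancel₀ hne (by linear_combination e1 - e2)
    subst haa
    have hbb : b = b' := add_left_cancel e1
    subst hbb
    exact hab'

end RingPattern

theorem corollary1 (S : Set (ℤ × ℤ)) (hS : SimplyConnectedComplex S)
    (P : Rings) (hP : IsOrthogonalRingPattern S P)
    (harea : ∀ v ∈ vertices S, P.area v = Real.pi)
    (ρ : ℤ × ℤ → ℝ) (hρ : HasRhoRadii S P 1 ρ) :
    (∃ Q : ℝ → Rings,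
      (∀ v ∈ vertices S, (Q 0).center v = P.center v) ∧
      (∀ v ∈ vertices S, Continuous fun δ => (Q δ).center v) ∧
      ∀ δ : ℝ, IsOrthogonalRingPattern S (Q δ) ∧
        HasRhoRadii S (Q δ) 1 (fun v => ρ v + δ) ∧
        ∀ v ∈ vertices S,
          (Q δ).r v = Real.sinh (ρ v + δ) ∧ (Q δ).R v = Real.cosh (ρ v + δ) ∧
            (Q δ).area v = Real.pi) ∧
    (SideConnected S → ∀ δ : ℝ, ∀ Q Q' : Rings,
      IsOrthogonalRingPattern S Q → HasRhoRadii S Q 1 (fun v => ρ v + δ) →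
      IsOrthogonalRingPattern S Q' → HasRhoRadii S Q' 1 (fun v => ρ v + δ) →
      ∃ a b : ℂ, ‖a‖ = 1 ∧ ∀ v ∈ vertices S, Q'.center v = a * Q.center v + b) := by
  refine ⟨?_, fun hSC δ Q Q' hQ hQρ hQ' hQρ' =>
    HasRhoRadii.exists_isometry hS.nonempty hSC hQ hQρ hQ' hQρ'⟩
  obtain ⟨o, ho⟩ := hS.nonempty
  have ho' : o ∈ vertices S := ⟨o, ho, by simp⟩
  refine ⟨shiftedRings S P ρ o, fun v hv => ?_, fun v hv => ?_, fun δ => ⟨?_, ?_, ?_⟩⟩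
  · simp only [shiftedRings, potential_of_reachable (hS.connected o ho' v hv)]
    -- For `δ = 0` the edge form is the difference of the old centers, so its sum telescopes.
    rw [show shiftedEdge P ρ 0 = fun v w => P.center w - P.center v from
      funext₂ (shiftedEdge_zero P ρ), walkSum_sub]
    ring
  · simp only [shiftedRings, potential_of_reachable (hS.connected o ho' v hv)]
    -- The chosen walk from `o` to `v` does not depend on `δ`, so the center is a finite sum of
    -- continuous terms.
    exact continuous_const.add (continuous_walkSum (continuous_shiftedEdge P ρ) _)
  · exact isOrthogonalRingPattern_shiftedRings hS hP hρ ho' δ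
  · exact fun v _ => ⟨(one_mul _).symm, (one_mul _).symm⟩
  · intro v _
    refine ⟨rfl, rfl, ?_⟩
    simp only [Rings.area, shiftedRings]
    rw [Real.cosh_sq]
    ring
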